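/- Let $M$ be an inverse monoid (every $a\in M$ has a unique $b\in M$ with $aba=a$ and $bab=b$) that has a finite inverse monoid presentation: $M\cong \mathrm{Inv}\langle X\mid R\rangle$ with $X$ and $R$ finite, i.e. $M$ is isomorphic to the quotient of the free monoid $\widetilde X^*$ on $\widetilde X=X\cup X^{-1}$ by the congruence generated by $R\subseteq\widetilde X^*\times\widetilde X^*$ together with all pairs $(ww^{-1}w,\,w)$ and $(uu^{-1}vv^{-1},\,vv^{-1}uu^{-1})$, $u,v,w\in\widetilde X^*$. Suppose that $M$ is finite-$\mathcal J$-above: for every $v\in M$ there are only finitely many $u\in M$ such that $v=xuy$ for some $x,y\in M$. For a subset $S\subseteq M$, say that $S$ has solvable membership problem if $M$ is finitely generated as a monoid and, for every finite generating family of $M$, there is an algorithm that, given a word in these generators, decides whether the element of $M$ represented by the word belongs to $S$. Then: 1. for every finite alphabet $A$, every monoid homomorphism $\varphi:A^*\to M$ and every context-free language $L\subseteq A^*$, the set $\varphi(L)$ has solvable membership problem; 2. in particular, every rational subset of $M$ has solvable membership problem (the rational subsets form the smallest family of subsets of $M$ that contains the finite subsets and is closed under binary union, product, and passing from a subset to the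 submonoid it generates); 3. in particular, every finitely generated submonoid of $M$ has solvable membership problem. -/

import Mathlib

open scoped Pointwise

namespace InvMon

universe u

/-- A monoid is inverse if every `a` has exactly one `b` with `a b a = a` and `b a b = b`. -/
def IsInverseMonoid (M : Type u) [Monoid M] : Prop :=
  ∀ a : M, ∃! b : M, a * b * a = a ∧ b * a * b = b

/-- Words over `A ∪ A⁻¹`: the letter `(a, true)` stands for `a`, and `(a, false)` for `a⁻¹`. -/
abbrev InvWord (α : Type u) : Type u := FreeMonoid (α × Bool)

/-- The formal inverse of a word: reverse it and invert every letter. -/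
def InvWord.inv {α : Type u} (w : InvWord α) : InvWord α :=
  FreeMonoid.ofList ((w.toList.map fun x => (x.1, !x.2)).reverse)

/-- The pairs `(w w⁻¹ w, w)` and `(u u⁻¹ v v⁻¹, v v⁻¹ u u⁻¹)`, which generate the Vagner
congruence, together with the pairs of `R`. -/
inductive InvRel {α : Type u} (R : Set (InvWord α × InvWord α)) : InvWord α → InvWord α → Prop
  | regular (w : InvWord α) : InvRel R (w * w.inv * w) w
  | commute (w v : InvWord α) :
      InvRel R (w * w.inv * (v * v.inv)) (v * v.inv * (w * w.inv))
  | rel (w v : InvWord α) (h : (w, v) ∈ R) : InvRel R w v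

/-- The inverse monoid `Inv⟨A | R⟩`: the quotient of the free monoid on `A ∪ A⁻¹` by the
congruence generated by the Vagner congruence and `R`. -/
abbrev InvPresented {α : Type u} (R : Set (InvWord α × InvWord α)) : Type u :=
  PresentedMonoid (InvRel R)

/-- `M` is isomorphic to `Inv⟨A | R⟩` with `A` and `R` finite. -/
def HasFiniteInvPresentation (M : Type u) [Monoid M] : Prop :=
  ∃ (n : ℕ) (R : Set (InvWord (Fin n) × InvWord (Fin n))),
    R.Finite ∧ Nonempty (InvPresented R ≃* M)

/-- `u` is a factor of `v`. -/
def IsFactor {M : Type u} [Monoid M] (u v : M) : Prop :=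
  ∃ x y : M, v = x * u * y

/-- Every element has only finitely many factors. -/
def FiniteJAbove (M : Type u) [Monoid M] : Prop :=
  ∀ v : M, {w : M | IsFactor w v}.Finite

/-- Rational subsets: the smallest family that contains the finite subsets and is closed under
binary union, product, and passing to the submonoid generated by a subset. -/
inductive IsRationalSubset {M : Type u} [Monoid M] : Set M → Prop
  | finite (S : Set M) (hS : S.Finite) : IsRationalSubset S
  | union (S T : Set M) (hS : IsRationalSubset S) (hT : IsRationalSubset T) :
      IsRationalSubset (S ∪ T)
  | mul (S T : Set M) (hS : IsRationalSubset S) (hT : IsRationalSubset T) :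
      IsRationalSubset (S * T)
  | star (S : Set M) (hS : IsRationalSubset S) :
      IsRationalSubset (Submonoid.closure S : Set M)

/-- The membership problem for the subset `S` of the finitely generated monoid `M` is solvable:
elements are given as words in a finite generating family, and whichever such family is used,
there is an algorithm that decides whether the element represented by a given word lies in `S`. -/
def MembershipSolvable {M : Type u} [Monoid M] (S : Set M) : Prop :=
  Monoid.FG M ∧
    ∀ (k : ℕ) (g : Fin k → M), Submonoid.closure (Set.range g) = ⊤ →
      ComputablePred fun w : List (Fin k) => (w.map g).prod ∈ S

/-- The image `φ(L)` of a language `L` under a homomorphism from the free monoid. -/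
def languageImage {A : Type*} {M : Type u} [Monoid M] (φ : FreeMonoid A →* M) (L : Language A) :
    Set M :=
  {m : M | ∃ w ∈ L, φ (FreeMonoid.ofList w) = m}

end InvMon

/-!
Let `m ∉ S`. Since `m` has only finitely many factors, the Rees congruence of the ideal of the
elements that are not factors of `m` has finite index, and it separates `m` from `S`. Hence a word
that does not represent an element of `S` is separated from the words that do by a finite automaton
respecting the relations of `M`, and nonmembership is semidecided by a search for the automaton.

Two universal conditions on an automaton have to be semidecided: that it respects the infinitely
many Vagner relations, and that it separates the given word from an infinite set of words
representing `S`. Both depend only on the finitely many classes of words that the automaton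
distinguishes, and these classes are generated inductively.

Membership is semidecidable because the congruence defining `M` and the set of words are
recursively enumerable. Rational subsets and homomorphic images of context-free languages are both
algebraic, that is, given by least solutions of finite systems of equations, so that one argument
covers them all.
-/

namespace InvMon

attribute [local fun_prop] Computable Computable.id Computable.const Computable.comp
  Computable.fst Computable.snd Computable.pair

section RecursivelyEnumerable

variable {α β : Type*} [Primcodable α] [Primcodable β]

theorem rePred_exists_nat {s : ℕ → α → Prop} (hs : PrimrecRel s) : REPred fun a => ∃ n, s n a := by
  classical
  have hdec : Primrec₂ fun (a : α) n => decide (s n a) := hs.decide.swap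
  refine (Partrec.dom_re (Partrec.rfind hdec.to_comp.partrec₂)).of_eq fun a => ?_
  simp [Nat.rfind_dom]

theorem exists_stages_of_rePred {p : α → Prop} (hp : REPred p) :
    ∃ s : ℕ → α → Prop, PrimrecRel s ∧ (∀ a, Monotone (s · a)) ∧ ∀ a, p a ↔ ∃ n, s n a := by
  obtain ⟨c, hc⟩ := Nat.Partrec.Code.exists_code.1 hp
  refine ⟨fun n a => (c.evaln n (Encodable.encode a)).isSome, ?_, fun a m n hmn h => ?_,
    fun a => ?_⟩
  · have heval : Primrec₂ fun n (a : α) => c.evaln n (Encodable.encode a) :=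
      Nat.Partrec.Code.primrec_evaln.comp <|
        (Primrec.fst.pair (Primrec.const c)).pair (Primrec.encode.comp Primrec.snd)
    exact Primrec.eq.comp (Primrec.option_isSome.comp heval) (Primrec.const true)
  · obtain ⟨y, hy⟩ := Option.isSome_iff_exists.1 h
    exact Option.isSome_iff_exists.2 ⟨y, Nat.Partrec.Code.evaln_mono hmn hy⟩
  · have hdom : p a ↔ (c.eval (Encodable.encode a)).Dom := by simp [hc, Part.assert]
    simp only [hdom, Option.isSome_iff_exists, Part.dom_iff_mem, ← Option.mem_def,
      Nat.Partrec.Code.evaln_complete]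
    exact exists_comm

theorem rePred_comp {p : β → Prop} (hp : REPred p) {f : α → β} (hf : Computable f) :
    REPred fun a => p (f a) :=
  Partrec.comp hp hf

theorem rePred_eq {f g : α → β} (hf : Computable f) (hg : Computable g) :
    REPred fun a => f a = g a :=
  rePred_comp (PrimrecPred.computablePred Primrec.eq).to_re (hf.pair hg)

theorem rePred_lt {f g : α → ℕ} (hf : Computable f) (hg : Computable g) :
    REPred fun a => f a < g a :=
  rePred_comp (PrimrecPred.computablePred Primrec.nat_lt).to_re (hf.pair hg)

theorem rePred_and {p q : α → Prop} (hp : REPred p) (hq : REPred q) :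
    REPred fun a => p a ∧ q a := by
  obtain ⟨s, hs, hsmono, hps⟩ := exists_stages_of_rePred hp
  obtain ⟨t, ht, htmono, hqt⟩ := exists_stages_of_rePred hq
  have hand : PrimrecRel fun n a => s n a ∧ t n a := PrimrecPred.and hs ht
  refine (rePred_exists_nat hand).of_eq fun a => ?_
  simp only [hps, hqt]
  constructor
  · rintro ⟨n, hsn, htn⟩
    exact ⟨⟨n, hsn⟩, n, htn⟩
  · rintro ⟨⟨m, hm⟩, n, hn⟩
    exact ⟨max m n, hsmono a (le_max_left m n) hm, htmono a (le_max_right m n) hn⟩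

theorem rePred_or {p q : α → Prop} (hp : REPred p) (hq : REPred q) :
    REPred fun a => p a ∨ q a := by
  obtain ⟨s, hs, -, hps⟩ := exists_stages_of_rePred hp
  obtain ⟨t, ht, -, hqt⟩ := exists_stages_of_rePred hq
  have hor : PrimrecRel fun n a => s n a ∨ t n a := PrimrecPred.or hs ht
  refine (rePred_exists_nat hor).of_eq fun a => ?_
  simp only [hps, hqt, exists_or]

theorem rePred_exists {p : α → β → Prop} (hp : REPred fun x : α × β => p x.1 x.2) :
    REPred fun a => ∃ b, p a b := by
  obtain ⟨s, hs, -, hps⟩ := exists_stages_of_rePred hp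
  have hdecode : PrimrecRel fun (k : ℕ) (a : α) =>
      ∃ b ∈ (Encodable.decode (α := β) k.unpair.2).toList, s k.unpair.1 (a, b) := by
    have hr : PrimrecRel fun (b : β) (x : ℕ × α) => s x.1.unpair.1 (x.2, b) :=
      hs.comp (Primrec.fst.comp (Primrec.unpair.comp (Primrec.fst.comp Primrec.snd)))
        ((Primrec.snd.comp Primrec.snd).pair Primrec.fst)
    exact hr.exists_mem_list.comp (Primrec.optionToList.comp (Primrec.decode.comp
      (Primrec.snd.comp (Primrec.unpair.comp Primrec.fst)))) Primrec.id
  refine (rePred_exists_nat hdecode).of_eq fun a => ?_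
  constructor
  · rintro ⟨k, b, -, hb⟩
    exact ⟨b, (hps (a, b)).2 ⟨_, hb⟩⟩
  · rintro ⟨b, hb⟩
    obtain ⟨n, hn⟩ := (hps (a, b)).1 hb
    exact ⟨Nat.pair n (Encodable.encode b), b, by simp, by simpa using hn⟩

theorem rePred_forall_mem {l : α → List β} (hl : Computable l) {p : α → β → Prop}
    (hp : REPred fun x : α × β => p x.1 x.2) : REPred fun a => ∀ b ∈ l a, p a b := by
  obtain ⟨s, hs, hmono, hps⟩ := exists_stages_of_rePred hp
  have hforall : PrimrecRel fun (n : ℕ) (x : List β × α) => ∀ b ∈ x.1, s n (x.2, b) := by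
    have hr : PrimrecRel fun (b : β) (x : ℕ × α) => s x.1 (x.2, b) :=
      hs.comp (Primrec.fst.comp Primrec.snd) ((Primrec.snd.comp Primrec.snd).pair Primrec.fst)
    exact hr.forall_mem_list.comp (Primrec.fst.comp Primrec.snd)
      (Primrec.fst.pair (Primrec.snd.comp Primrec.snd))
  refine (rePred_comp (rePred_exists_nat hforall) (hl.pair .id)).of_eq fun a => ?_
  have hbounded (L : List β) : (∃ n, ∀ b ∈ L, s n (a, b)) ↔ ∀ b ∈ L, ∃ n, s n (a, b) := by
    induction L with
    | nil => simp
    | cons b L ih =>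
      simp only [List.forall_mem_cons, ← ih]
      constructor
      · rintro ⟨n, hb, hL⟩
        exact ⟨⟨n, hb⟩, n, hL⟩
      · rintro ⟨⟨m, hb⟩, n, hL⟩
        exact ⟨max m n, hmono _ (le_max_left m n) hb,
          fun c hc => hmono _ (le_max_right m n) (hL c hc)⟩
  exact (hbounded (l a)).trans (forall₂_congr fun b _ => (hps (a, b)).symm)

theorem rePred_mem {l : α → List β} (hl : Computable l) {f : α → β} (hf : Computable f) :
    REPred fun a => f a ∈ l a := by
  have hmem : PrimrecRel fun (L : List β) (b : β) => b ∈ L :=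
    Primrec.eq.exists_mem_list.of_eq fun L b => by simp
  exact rePred_comp (PrimrecPred.computablePred hmem).to_re (hl.pair hf)

theorem rePred_exists_mem {l : α → List β} (hl : Computable l) {p : α → β → Prop}
    (hp : REPred fun x : α × β => p x.1 x.2) : REPred fun a => ∃ b ∈ l a, p a b :=
  rePred_exists (rePred_and (rePred_mem (by fun_prop) (by fun_prop)) hp)

theorem rePred_mem_of_finite {s : Set α} (hs : s.Finite) : REPred (· ∈ s) := by
  refine (rePred_mem (.const hs.toFinset.toList) .id).of_eq fun a => ?_
  simp

end RecursivelyEnumerable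

section Generation

/-- The elements inferred from those of `base`, where `a` and `b` together yield all of
`step a b`. Derivations in congruences and in systems of equations are of this form. -/
inductive Generated {α : Type*} (base : Set α) (step : α → α → List α) : α → Prop
  | base {a : α} (ha : a ∈ base) : Generated base step a
  | step {a b c : α} (ha : Generated base step a) (hb : Generated base step b)
      (hc : c ∈ step a b) : Generated base step c

variable {α : Type*} {base : Set α} {step : α → α → List α}

/-- A ranked derivation lists elements with ranks so that every element outside of `base` is
inferred from listed elements of smaller rank. -/
def IsRankedDerivation (base : Set α) (step : α → α → List α) (D : List (ℕ × α)) : Prop :=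
  ∀ x ∈ D, x.2 ∈ base ∨ ∃ y ∈ D, ∃ z ∈ D, (y.1 < x.1 ∧ z.1 < x.1) ∧ x.2 ∈ step y.2 z.2

theorem IsRankedDerivation.generated {D : List (ℕ × α)} (hD : IsRankedDerivation base step D)
    (n : ℕ) (a : α) (ha : (n, a) ∈ D) : Generated base step a := by
  induction n using Nat.strong_induction_on generalizing a with
  | _ n ih =>
    rcases hD _ ha with hbase | ⟨y, hy, z, hz, ⟨hyn, hzn⟩, hstep⟩
    · exact .base hbase
    · exact .step (ih y.1 hyn y.2 hy) (ih z.1 hzn z.2 hz) hstep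

theorem Generated.exists_isRankedDerivation {a : α} (ha : Generated base step a) :
    ∃ D n, IsRankedDerivation base step D ∧ (n, a) ∈ D := by
  induction ha with
  | @base a ha => exact ⟨[(0, a)], 0, by simp [IsRankedDerivation, ha], by simp⟩
  | @step a b c _ _ hc iha ihb =>
    obtain ⟨D, m, hD, hDa⟩ := iha
    obtain ⟨E, n, hE, hEb⟩ := ihb
    refine ⟨(m + n + 1, c) :: (D ++ E), m + n + 1, ?_, List.mem_cons_self⟩
    have hsub₁ : D ⊆ (m + n + 1, c) :: (D ++ E) := fun x hx => by simp [hx]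
    have hsub₂ : E ⊆ (m + n + 1, c) :: (D ++ E) := fun x hx => by simp [hx]
    intro x hx
    rcases List.mem_cons.1 hx with rfl | hx
    · exact .inr ⟨_, hsub₁ hDa, _, hsub₂ hEb, ⟨by dsimp; lia, by dsimp; lia⟩, hc⟩
    rcases List.mem_append.1 hx with hx | hx
    · exact (hD x hx).imp_right fun ⟨y, hy, z, hz, h⟩ => ⟨y, hsub₁ hy, z, hsub₁ hz, h⟩
    · exact (hE x hx).imp_right fun ⟨y, hy, z, hz, h⟩ => ⟨y, hsub₂ hy, z, hsub₂ hz, h⟩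

theorem rePred_generated [Primcodable α] (hbase : REPred (· ∈ base)) (hstep : Computable₂ step) :
    REPred (Generated base step) := by
  have hranked : REPred (IsRankedDerivation base step) := by
    refine rePred_forall_mem .id (rePred_or (rePred_comp hbase (by fun_prop)) ?_)
    refine rePred_exists_mem (by fun_prop) (rePred_exists_mem (by fun_prop) ?_)
    refine rePred_and (rePred_and (rePred_lt (by fun_prop) (by fun_prop))
      (rePred_lt (by fun_prop) (by fun_prop)))
      (rePred_mem (hstep.comp (by fun_prop) (by fun_prop)) (by fun_prop))
  have hwitness : REPred fun a => ∃ x : List (ℕ × α) × ℕ,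
      IsRankedDerivation base step x.1 ∧ (x.2, a) ∈ x.1 :=
    rePred_exists (rePred_and (rePred_comp hranked (by fun_prop))
      (rePred_mem (by fun_prop) (by fun_prop)))
  refine hwitness.of_eq fun a => ⟨?_, fun ha => ?_⟩
  · rintro ⟨⟨D, n⟩, hD, ha⟩
    exact hD.generated n a ha
  · obtain ⟨D, n, hD, hDa⟩ := ha.exists_isRankedDerivation
    exact ⟨(D, n), hD, hDa⟩

/-- Only the `f`-classes of generated elements matter for `p`, so a set `Q` of representatives of
these finitely many classes is a finite witness for the universal statement. -/
theorem forall_generated_iff {β : Type*} [Finite β] (f : α → β)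
    (hstep : ∀ a a' b b', f a = f a' → f b = f b' → (step a b).map f = (step a' b').map f)
    {p : α → α → Prop} (hp : ∀ a a' b b', f a = f a' → f b = f b' → p a b → p a' b') :
    (∀ a b, Generated base step a → Generated base step b → p a b) ↔
      ∃ Q : List α, (∀ a ∈ base, ∃ q ∈ Q, f q = f a) ∧
        (∀ a ∈ Q, ∀ b ∈ Q, ∀ c ∈ step a b, ∃ q ∈ Q, f q = f c) ∧ ∀ a ∈ Q, ∀ b ∈ Q, p a b := by
  constructor
  · intro h
    obtain ⟨Q, hQ, hbij⟩ := Set.exists_subset_bijOn {a | Generated base step a} f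
    have hfin : Q.Finite := Set.Finite.of_finite_image (Set.toFinite _) hbij.injOn
    have hrep {a : α} (ha : Generated base step a) : ∃ q ∈ hfin.toFinset.toList, f q = f a := by
      simpa using hbij.surjOn ⟨a, ha, rfl⟩
    have hgen {a : α} (ha : a ∈ hfin.toFinset.toList) : Generated base step a :=
      hQ (by simpa using ha)
    exact ⟨hfin.toFinset.toList, fun a ha => hrep (.base ha),
      fun a ha b hb c hc => hrep (.step (hgen ha) (hgen hb) hc),
      fun a ha b hb => h a b (hgen ha) (hgen hb)⟩
  · rintro ⟨Q, hbase, hclosed, hQ⟩ a b ha hb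
    have hrep {a : α} (ha : Generated base step a) : ∃ q ∈ Q, f q = f a := by
      induction ha with
      | base ha => exact hbase _ ha
      | @step a b c _ _ hc iha ihb =>
        obtain ⟨q, hq, hqa⟩ := iha
        obtain ⟨r, hr, hrb⟩ := ihb
        have hfc : f c ∈ (step q r).map f := hstep q a r b hqa hrb ▸ List.mem_map_of_mem hc
        obtain ⟨d, hd, hdc⟩ := List.mem_map.1 hfc
        obtain ⟨t, ht, htd⟩ := hclosed q hq r hr d hd
        exact ⟨t, ht, htd.trans hdc⟩
    obtain ⟨q, hq, hqa⟩ := hrep ha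
    obtain ⟨r, hr, hrb⟩ := hrep hb
    exact hp q a r b hqa hrb (hQ q hq r hr)

theorem rePred_forall_generated {γ : Type*} [Primcodable α] [Primcodable γ]
    {β : γ → Type*} [∀ c, Finite (β c)] (f : ∀ c, α → β c)
    (hf : REPred fun x : γ × α × α => f x.1 x.2.1 = f x.1 x.2.2)
    (hbase : base.Finite) (hstep : Computable₂ step)
    (hfstep : ∀ c a a' b b', f c a = f c a' → f c b = f c b' →
      (step a b).map (f c) = (step a' b').map (f c))
    {p : γ → α → α → Prop} (hp : REPred fun x : γ × α × α => p x.1 x.2.1 x.2.2)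
    (hfp : ∀ c a a' b b', f c a = f c a' → f c b = f c b' → p c a b → p c a' b') :
    REPred fun c => ∀ a b, Generated base step a → Generated base step b → p c a b := by
  have hrep : REPred fun x : (γ × List α) × α => ∃ q ∈ x.1.2, f x.1.1 q = f x.1.1 x.2 :=
    rePred_exists_mem (by fun_prop) <|
      rePred_comp (f := fun x : ((γ × List α) × α) × α => (x.1.1.1, x.2, x.1.2)) hf (by fun_prop)
  have hcovers : REPred fun x : γ × List α =>
      ∀ a ∈ hbase.toFinset.toList, ∃ q ∈ x.2, f x.1 q = f x.1 a :=
    rePred_forall_mem (.const _) hrep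
  simp only [Finset.mem_toList, Set.Finite.mem_toFinset] at hcovers
  have hclosed : REPred fun x : γ × List α =>
      ∀ a ∈ x.2, ∀ b ∈ x.2, ∀ c ∈ step a b, ∃ q ∈ x.2, f x.1 q = f x.1 c :=
    rePred_forall_mem (by fun_prop) <| rePred_forall_mem (by fun_prop) <|
      rePred_forall_mem (hstep.comp (by fun_prop) (by fun_prop)) <|
        rePred_comp (f := fun x : (((γ × List α) × α) × α) × α => (x.1.1.1, x.2)) hrep
          (by fun_prop)
  have hvalid : REPred fun x : γ × List α => ∀ a ∈ x.2, ∀ b ∈ x.2, p x.1 a b :=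
    rePred_forall_mem (by fun_prop) <| rePred_forall_mem (by fun_prop) <|
      rePred_comp (f := fun x : ((γ × List α) × α) × α => (x.1.1.1, x.1.2, x.2)) hp
        (by fun_prop)
  refine REPred.of_eq (rePred_exists ?_) fun c =>
    (forall_generated_iff (f c) (hfstep c) (hfp c)).symm
  exact rePred_and hcovers (rePred_and hclosed hvalid)

end Generation

section FreeMonoid

variable {α X : Type*} [Primcodable α] [Primcodable X]

instance : Primcodable (FreeMonoid X) := inferInstanceAs (Primcodable (List X))

theorem computable_freeMonoid_mul {f g : α → FreeMonoid X} (hf : Computable f)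
    (hg : Computable g) : Computable fun a => f a * g a :=
  Computable.list_append.comp hf hg

end FreeMonoid

attribute [local fun_prop] computable_freeMonoid_mul

section Automata

variable {α X : Type*} [Primcodable α] [Primcodable X]

theorem exists_list_getD_encode_eq {Y : Type*} [Encodable Y] {s : Set Y} (hs : s.Finite)
    (g : Y → ℕ) : ∃ l : List ℕ, ∀ y ∈ s, l.getD (Encodable.encode y) 0 = g y := by
  obtain ⟨N, hN⟩ := (hs.image Encodable.encode).bddAbove
  refine ⟨(List.range (N + 1)).map fun k => (Encodable.decode k).elim 0 g, fun y hy => ?_⟩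
  have hlt : Encodable.encode y < N + 1 := Nat.lt_succ_of_le (hN ⟨y, hy, rfl⟩)
  simp [List.getD_eq_getElem?_getD, hlt]

/-- The code `(n, l)` describes an automaton with states `0, …, n` in which a letter `x` moves
the state `s` to the entry of `l`, modulo `n + 1`, at the position `Encodable.encode (s, x)`. -/
abbrev AutomatonCode := ℕ × List ℕ

namespace AutomatonCode

/-- The successor of the state `s` under the letter `x`. -/
def next (c : AutomatonCode) (x : X) (s : ℕ) : ℕ :=
  c.2.getD (Encodable.encode (s, x)) 0 % (c.1 + 1)

/-- The action of words on the states. -/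
def action (c : AutomatonCode) : FreeMonoid X →* Function.End (Fin (c.1 + 1)) :=
  FreeMonoid.lift fun x s => ⟨c.next x s, Nat.mod_lt _ c.1.succ_pos⟩

/-- The congruence of the words that act alike, that is, the kernel of the transition monoid.
Over a finite alphabet these are exactly the congruences of finite index. -/
def con (c : AutomatonCode) : Con (FreeMonoid X) := Con.ker c.action

theorem val_action (c : AutomatonCode) (u : FreeMonoid X) (s : Fin (c.1 + 1)) :
    (c.action u s : ℕ) = u.toList.foldr c.next (s : ℕ) := by
  induction u using FreeMonoid.inductionOn' with
  | one => rfl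
  | of_mul x u ih =>
    rw [map_mul]
    change c.next x (c.action u s : ℕ) = _
    rw [ih]
    rfl

theorem con_iff (c : AutomatonCode) (u v : FreeMonoid X) :
    c.con u v ↔ ∀ s < c.1 + 1, u.toList.foldr c.next s = v.toList.foldr c.next s := by
  rw [con, Con.ker_rel]
  refine (funext_iff (f := c.action u) (g := c.action v)).trans ?_
  simp only [Fin.ext_iff, val_action, Fin.forall_iff]

theorem computablePred_con :
    ComputablePred fun x : AutomatonCode × FreeMonoid X × FreeMonoid X => x.1.con x.2.1 x.2.2 := by
  have hnext : Primrec fun x : AutomatonCode × X × ℕ => x.1.next x.2.1 x.2.2 :=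
    Primrec.nat_mod.comp
      ((Primrec.list_getD 0).comp (Primrec.snd.comp Primrec.fst) (Primrec.encode.comp
        ((Primrec.snd.comp Primrec.snd).pair (Primrec.fst.comp Primrec.snd))))
      (Primrec.succ.comp (Primrec.fst.comp Primrec.fst))
  have hrun : Primrec fun x : AutomatonCode × FreeMonoid X × ℕ =>
      x.2.1.toList.foldr x.1.next x.2.2 :=
    Primrec.list_foldr (Primrec.fst.comp Primrec.snd) (Primrec.snd.comp Primrec.snd)
      (hnext.comp ((Primrec.fst.comp Primrec.fst).pair Primrec.snd)).to₂
  have hagree : PrimrecRel fun (s : ℕ) (x : AutomatonCode × FreeMonoid X × FreeMonoid X) =>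
      x.2.1.toList.foldr x.1.next s = x.2.2.toList.foldr x.1.next s :=
    Primrec.eq.comp
      (hrun.comp ((Primrec.fst.comp Primrec.snd).pair
        ((Primrec.fst.comp (Primrec.snd.comp Primrec.snd)).pair Primrec.fst)))
      (hrun.comp ((Primrec.fst.comp Primrec.snd).pair
        ((Primrec.snd.comp (Primrec.snd.comp Primrec.snd)).pair Primrec.fst)))
  refine PrimrecPred.computablePred <| PrimrecPred.of_eq (hagree.forall_mem_list.comp
    (Primrec.list_range.comp (Primrec.succ.comp (Primrec.fst.comp Primrec.fst))) Primrec.id)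
    fun x => ?_
  simp only [con_iff, List.mem_range, id_eq, Nat.succ_eq_add_one]

instance finite_quotient_con (c : AutomatonCode) :
    Finite (c.con : Con (FreeMonoid X)).Quotient :=
  have : Finite (Function.End (Fin (c.1 + 1))) := inferInstanceAs (Finite (Fin _ → Fin _))
  Finite.of_injective _ (Con.kerLift_injective c.action)

theorem rePred_con {c : α → AutomatonCode} {u v : α → FreeMonoid X} (hc : Computable c)
    (hu : Computable u) (hv : Computable v) : REPred fun a => (c a).con (u a) (v a) :=
  rePred_comp computablePred_con.to_re (hc.pair (hu.pair hv))

theorem rePred_not_con {c : α → AutomatonCode} {u v : α → FreeMonoid X} (hc : Computable c)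
    (hu : Computable u) (hv : Computable v) : REPred fun a => ¬ (c a).con (u a) (v a) :=
  rePred_comp computablePred_con.not.to_re (hc.pair (hu.pair hv))

theorem exists_con_eq [Finite X] (d : Con (FreeMonoid X)) [Finite d.Quotient] :
    ∃ c : AutomatonCode, c.con = d := by
  obtain ⟨n, ⟨e⟩⟩ : ∃ n, Nonempty (d.Quotient ≃ Fin (n + 1)) :=
    ⟨Nat.card d.Quotient - 1, ⟨(Finite.equivFin _).trans (finCongr
      (Nat.succ_pred_eq_of_pos Nat.card_pos).symm)⟩⟩
  let cayley : FreeMonoid X →* Function.End (Fin (n + 1)) :=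
    { toFun u s := e (u * e.symm s)
      map_one' := funext fun s => by simp [Function.End.one_def]
      map_mul' u v := funext fun s => by
        change _ = e (u * e.symm (e (v * e.symm s)))
        simp [mul_assoc] }
  obtain ⟨l, hl⟩ := exists_list_getD_encode_eq
    (Set.finite_range fun y : Fin (n + 1) × X => ((y.1 : ℕ), y.2))
    fun y => cayley (.of y.2) (Fin.ofNat (n + 1) y.1)
  have haction : action (n, l) = cayley := FreeMonoid.hom_eq fun x => funext fun s => by
    have hentry := hl _ ⟨(s, x), rfl⟩
    rw [Fin.ofNat_val_eq_self] at hentry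
    refine Fin.ext ?_
    rw [val_action]
    change l.getD (Encodable.encode ((s : ℕ), x)) 0 % (n + 1) = _
    rw [hentry, Nat.mod_eq_of_lt (Fin.isLt _)]
  refine ⟨(n, l), Con.ext fun u v => ?_⟩
  rw [con, haction, Con.ker_rel]
  refine ⟨fun h => ?_, fun h => ?_⟩
  · have hone : e (u * e.symm (e 1)) = e (v * e.symm (e 1)) := congrFun h (e 1)
    simpa using hone
  · exact congrArg (fun (q : d.Quotient) s => e (q * e.symm s)) ((Con.eq d).2 h)

end AutomatonCode

end Automata

section GeneratedCongruence

variable {M : Type*} [Monoid M]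

/-- The inferences by symmetry, multiplication and transitivity from two pairs in a
congruence. -/
def conStep [DecidableEq M] (x y : M × M) : List (M × M) :=
  [(x.2, x.1), (x.1 * y.1, x.2 * y.2)] ++ if x.2 = y.1 then [(x.1, y.2)] else []

theorem conGen_iff_generated [DecidableEq M] {r : M → M → Prop} {u v : M} :
    conGen r u v ↔ Generated {x : M × M | x.1 = x.2 ∨ r x.1 x.2} conStep (u, v) := by
  constructor
  · intro h
    induction h with
    | of u v h => exact .base (.inr h)
    | refl u => exact .base (.inl rfl)
    | symm _ ih => exact .step ih ih (by simp [conStep])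
    | trans _ _ ih₁ ih₂ => exact .step ih₁ ih₂ (by simp [conStep])
    | mul _ _ ih₁ ih₂ => exact .step ih₁ ih₂ (by simp [conStep])
  · intro h
    generalize hx : (u, v) = x at h
    obtain ⟨rfl, rfl⟩ : u = x.1 ∧ v = x.2 := by simp [← hx]
    clear hx
    induction h with
    | @base x hx => exact hx.elim (fun h => h ▸ (conGen r).refl _) (.of _ _)
    | @step x y z _ _ hz ihx ihy =>
      simp only [conStep, List.mem_append, List.mem_cons, List.not_mem_nil, or_false,
        List.mem_ite_nil_right] at hz
      rcases hz with (rfl | rfl) | ⟨hxy, rfl⟩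
      · exact (conGen r).symm ihx
      · exact (conGen r).mul ihx ihy
      · exact (conGen r).trans ihx (hxy ▸ ihy)

theorem rePred_conGen {X : Type*} [Primcodable X] {r : FreeMonoid X → FreeMonoid X → Prop}
    (hr : REPred fun x : FreeMonoid X × FreeMonoid X => r x.1 x.2) :
    REPred fun x : FreeMonoid X × FreeMonoid X => conGen r x.1 x.2 := by
  classical
  have hstep : Computable₂ (conStep (M := FreeMonoid X)) := by
    have hite : Primrec fun z : (FreeMonoid X × FreeMonoid X) × FreeMonoid X × FreeMonoid X =>
        if z.1.2 = z.2.1 then [(z.1.1, z.2.2)] else [] :=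
      Primrec.ite (Primrec.eq.comp (Primrec.snd.comp Primrec.fst) (Primrec.fst.comp Primrec.snd))
        (Primrec.list_cons.comp ((Primrec.fst.comp Primrec.fst).pair
          (Primrec.snd.comp Primrec.snd)) (Primrec.const [])) (Primrec.const [])
    exact Computable.list_append.comp (Computable.list_cons.comp (by fun_prop)
      (Computable.list_cons.comp (by fun_prop) (.const []))) hite.to_comp
  have hbase : REPred (· ∈ {x : FreeMonoid X × FreeMonoid X | x.1 = x.2 ∨ r x.1 x.2}) :=
    rePred_or (rePred_eq .fst .snd) hr
  exact (rePred_generated hbase hstep).of_eq fun x => conGen_iff_generated.symm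

end GeneratedCongruence

section InversePresentation

variable {α : Type*} {R : Set (InvWord α × InvWord α)}

theorem InvWord.inv_mul (u v : InvWord α) : (u * v).inv = v.inv * u.inv := by
  simp [InvWord.inv]

theorem conGen_invRel_le_iff (d : Con (InvWord α)) :
    conGen (InvRel R) ≤ d ↔ (∀ x ∈ R, d x.1 x.2) ∧ ∀ u v : InvWord α,
      d (u * u.inv * u) u ∧ d (u * u.inv * (v * v.inv)) (v * v.inv * (u * u.inv)) := by
  rw [Con.conGen_le]
  constructor
  · exact fun h => ⟨fun x hx => h _ _ (.rel _ _ hx),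
      fun u v => ⟨h _ _ (.regular u), h _ _ (.commute u v)⟩⟩
  · rintro ⟨hR, hvagner⟩ _ w (_ | ⟨u, v⟩ | ⟨_, _, huv⟩)
    · exact (hvagner w 1).1
    · exact (hvagner u v).2
    · exact hR _ huv

theorem generated_of_letters {X : Type*} (w : FreeMonoid X) :
    Generated (insert 1 (Set.range FreeMonoid.of)) (fun u v => [u * v]) w := by
  induction w using FreeMonoid.inductionOn' with
  | one => exact .base (Set.mem_insert _ _)
  | of_mul x u ih =>
    exact .step (.base (Set.mem_insert_of_mem _ ⟨x, rfl⟩)) ih (List.mem_singleton_self _)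

variable [Primcodable α]

theorem computable_inv : Computable (InvWord.inv : InvWord α → InvWord α) := by
  have hflip : Primrec fun x : α × Bool => (x.1, !x.2) :=
    Primrec.fst.pair (Primrec.not.comp Primrec.snd)
  exact (Primrec.list_reverse.comp
    (Primrec.list_map Primrec.id (hflip.comp Primrec.snd).to₂)).to_comp

attribute [local fun_prop] computable_inv

theorem rePred_invRel (hR : R.Finite) :
    REPred fun x : InvWord α × InvWord α => InvRel R x.1 x.2 := by
  have hregular : REPred fun x : InvWord α × InvWord α => x.1 = x.2 * x.2.inv * x.2 :=
    rePred_eq (by fun_prop) (by fun_prop)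
  have hcommute : REPred fun x : InvWord α × InvWord α => ∃ y : InvWord α × InvWord α,
      x.1 = y.1 * y.1.inv * (y.2 * y.2.inv) ∧ x.2 = y.2 * y.2.inv * (y.1 * y.1.inv) :=
    rePred_exists (rePred_and (rePred_eq (by fun_prop) (by fun_prop))
      (rePred_eq (by fun_prop) (by fun_prop)))
  refine (rePred_or hregular (rePred_or hcommute (rePred_mem_of_finite hR))).of_eq ?_
  rintro ⟨u, v⟩
  constructor
  · rintro (h | ⟨⟨w, z⟩, hu, hv⟩ | h)
    · exact (show u = _ from h) ▸ .regular v
    · dsimp only at hu hv ⊢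
      exact hu ▸ hv ▸ .commute w z
    · exact .rel u v h
  · intro (h : InvRel R u v)
    rcases h with w | ⟨w, z⟩ | ⟨_, _, h⟩
    · exact .inl rfl
    · exact .inr (.inl ⟨(w, z), rfl, rfl⟩)
    · exact .inr (.inr h)

theorem rePred_conGen_invRel_le [Finite α] (hR : R.Finite) :
    REPred fun c : AutomatonCode => conGen (InvRel R) ≤ c.con := by
  have hrel : REPred fun c : AutomatonCode => ∀ x ∈ hR.toFinset.toList, c.con x.1 x.2 :=
    rePred_forall_mem (.const _)
      (AutomatonCode.rePred_con (by fun_prop) (by fun_prop) (by fun_prop))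
  simp only [Finset.mem_toList, Set.Finite.mem_toFinset] at hrel
  have hcheck : REPred fun x : AutomatonCode × InvWord α × InvWord α =>
      x.1.con (x.2.1 * x.2.1.inv * x.2.1) x.2.1 ∧
        x.1.con (x.2.1 * x.2.1.inv * (x.2.2 * x.2.2.inv))
          (x.2.2 * x.2.2.inv * (x.2.1 * x.2.1.inv)) :=
    rePred_and (AutomatonCode.rePred_con (by fun_prop) (by fun_prop) (by fun_prop))
      (AutomatonCode.rePred_con (by fun_prop) (by fun_prop) (by fun_prop))
  have hvagner : REPred fun c : AutomatonCode => ∀ u v : InvWord α,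
      Generated (insert 1 (Set.range FreeMonoid.of)) (fun u v => [u * v]) u →
      Generated (insert 1 (Set.range FreeMonoid.of)) (fun u v => [u * v]) v →
      c.con (u * u.inv * u) u ∧ c.con (u * u.inv * (v * v.inv)) (v * v.inv * (u * u.inv)) := by
    let classes (c : AutomatonCode) (w : InvWord α) :
        (c.con : Con (InvWord α)).Quotient × (c.con : Con (InvWord α)).Quotient := (w, w.inv)
    refine rePred_forall_generated classes ?_ ((Set.finite_range _).insert 1) ?_ ?_ hcheck ?_
    · simp only [classes, Prod.mk.injEq, Con.eq]
      exact rePred_and (AutomatonCode.rePred_con (by fun_prop) (by fun_prop) (by fun_prop))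
        (AutomatonCode.rePred_con (by fun_prop) (by fun_prop) (by fun_prop))
    · exact Computable.list_cons.comp (by fun_prop) (.const [])
    · intro c u u' v v' hu hv
      simp only [classes, Prod.mk.injEq] at hu hv
      simp only [classes, List.map_cons, List.map_nil, InvWord.inv_mul, Con.coe_mul, hu, hv]
    · intro c u u' v v' hu hv
      simp only [classes, Prod.mk.injEq] at hu hv
      simp only [← Con.eq, Con.coe_mul, hu, hv, imp_self]
  refine (rePred_and hrel hvagner).of_eq fun c => ?_
  simp only [conGen_invRel_le_iff, generated_of_letters, true_implies]

end InversePresentation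

section ProfinitelyClosed

variable {M : Type*} [Monoid M]

/-- Closed subsets for the profinite topology: every element outside of `S` is separated from
`S` by a congruence of finite index. -/
def IsProfinitelyClosed (S : Set M) : Prop :=
  ∀ m ∉ S, ∃ d : Con M, Finite d.Quotient ∧ ∀ s ∈ S, ¬ d s m

theorem IsFactor.of_mul_left {a b m : M} (h : IsFactor (a * b) m) : IsFactor a m := by
  obtain ⟨x, y, rfl⟩ := h
  exact ⟨x, b * y, by simp only [mul_assoc]⟩

theorem IsFactor.of_mul_right {a b m : M} (h : IsFactor (a * b) m) : IsFactor b m := by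
  obtain ⟨x, y, rfl⟩ := h
  exact ⟨x * a, y, by simp only [mul_assoc]⟩

theorem IsFactor.refl (m : M) : IsFactor m m := ⟨1, 1, by simp only [one_mul, mul_one]⟩

/-- The Rees congruence of the ideal of the elements that are not factors of `m`. -/
def nonFactorCon (m : M) : Con M where
  r a b := a = b ∨ ¬ IsFactor a m ∧ ¬ IsFactor b m
  iseqv.refl _ := .inl rfl
  iseqv.symm h := h.imp Eq.symm And.symm
  iseqv.trans := by
    rintro a b c (rfl | h) (rfl | h')
    · exact .inl rfl
    · exact .inr h'
    · exact .inr h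
    · exact .inr ⟨h.1, h'.2⟩
  mul' := by
    rintro a b c d (rfl | h) (rfl | h')
    · exact .inl rfl
    · exact .inr ⟨fun h => h'.1 h.of_mul_right, fun h => h'.2 h.of_mul_right⟩
    · exact .inr ⟨fun h' => h.1 h'.of_mul_left, fun h' => h.2 h'.of_mul_left⟩
    · exact .inr ⟨fun h' => h.1 h'.of_mul_left, fun h' => h.2 h'.of_mul_left⟩

theorem nonFactorCon_iff {m a b : M} :
    nonFactorCon m a b ↔ a = b ∨ ¬ IsFactor a m ∧ ¬ IsFactor b m := Iff.rfl

theorem finite_quotient_nonFactorCon {m : M} (hm : {a : M | IsFactor a m}.Finite) :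
    Finite (nonFactorCon m).Quotient := by
  let mk : M → (nonFactorCon m).Quotient := (↑)
  have hcollapse : (mk '' {a | ¬ IsFactor a m}).Subsingleton := by
    rintro _ ⟨a, ha, rfl⟩ _ ⟨b, hb, rfl⟩
    exact (Con.eq _).2 (.inr ⟨ha, hb⟩)
  refine Set.finite_univ_iff.1 (((hm.image mk).union hcollapse.finite).subset fun q _ => ?_)
  induction q using Con.induction_on with
  | H a => exact (em (IsFactor a m)).imp (Set.mem_image_of_mem mk) (Set.mem_image_of_mem mk)

theorem FiniteJAbove.isProfinitelyClosed (hM : FiniteJAbove M) (S : Set M) :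
    IsProfinitelyClosed S := by
  refine fun m hm => ⟨nonFactorCon m, finite_quotient_nonFactorCon (hM m), fun s hs h => ?_⟩
  rcases nonFactorCon_iff.1 h with rfl | ⟨-, hmm⟩
  · exact hm hs
  · exact hmm (.refl m)

end ProfinitelyClosed

section AlgebraicSystem

/-- A system of equations `x i = ⋃ {m} ∪ ⋃ x j * x k` for subsets `x i` of a monoid, where the
unions are over the pairs `(i, m)` of `const` and the triples `(i, j, k)` of `prod`.
Context-free grammars in Chomsky normal form are such systems over a free monoid. -/
structure AlgebraicSystem (I M : Type*) where
  const : Set (I × M)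
  prod : Set (I × I × I)

namespace AlgebraicSystem

variable {I J M N : Type*} [Monoid M] [Monoid N]

/-- Membership in the components of the least solution. -/
inductive Derives (E : AlgebraicSystem I M) : I → M → Prop
  | const {i : I} {m : M} (h : (i, m) ∈ E.const) : E.Derives i m
  | prod {i j k : I} {a b : M} (h : (i, j, k) ∈ E.prod) (ha : E.Derives j a)
      (hb : E.Derives k b) : E.Derives i (a * b)

/-- The union of the components in `s` of the least solution. -/
def solution (E : AlgebraicSystem I M) (s : Set I) : Set M := {m | ∃ i ∈ s, E.Derives i m}

/-- The system with the constants mapped along `g`. -/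
def map (g : M → N) (E : AlgebraicSystem I M) : AlgebraicSystem I N where
  const := Prod.map id g '' E.const
  prod := E.prod

theorem derives_map_iff (π : M →* N) (E : AlgebraicSystem I M) {i : I} {n : N} :
    (E.map π).Derives i n ↔ ∃ m, E.Derives i m ∧ π m = n := by
  constructor
  · intro h
    induction h with
    | const h =>
      obtain ⟨⟨i, m⟩, him, heq⟩ := h
      obtain ⟨rfl, rfl⟩ := Prod.mk.inj heq
      exact ⟨m, .const him, rfl⟩
    | prod h _ _ iha ihb =>
      obtain ⟨a, ha, rfl⟩ := iha
      obtain ⟨b, hb, rfl⟩ := ihb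
      exact ⟨a * b, .prod h ha hb, map_mul π a b⟩
  · rintro ⟨m, h, rfl⟩
    induction h with
    | const h => exact .const ⟨_, h, rfl⟩
    | prod h _ _ iha ihb => exact map_mul π _ _ ▸ .prod h iha ihb

theorem solution_map (π : M →* N) (E : AlgebraicSystem I M) (s : Set I) :
    (E.map π).solution s = π '' E.solution s := by
  ext n
  simp only [solution, derives_map_iff]
  constructor
  · rintro ⟨i, hi, m, h, rfl⟩
    exact ⟨m, ⟨i, hi, h⟩, rfl⟩
  · rintro ⟨m, ⟨i, hi, h⟩, rfl⟩
    exact ⟨i, hi, m, h, rfl⟩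

/-- The system whose equation for `j` is that for `f j`, as far as it involves only indices in
the range of `f`. -/
def comap (f : J → I) (E : AlgebraicSystem I M) : AlgebraicSystem J M where
  const := {x | (f x.1, x.2) ∈ E.const}
  prod := {x | (f x.1, f x.2.1, f x.2.2) ∈ E.prod}

theorem derives_comap_iff {f : J → I} {E : AlgebraicSystem I M}
    (hf : ∀ j i k, (f j, i, k) ∈ E.prod → i ∈ Set.range f ∧ k ∈ Set.range f) {j : J} {m : M} :
    (E.comap f).Derives j m ↔ E.Derives (f j) m := by
  constructor
  · intro h
    induction h with
    | const h => exact .const h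
    | prod h _ _ iha ihb => exact .prod h iha ihb
  · intro h
    generalize hi : f j = i at h
    induction h generalizing j with
    | const h => subst hi; exact .const h
    | prod h _ _ iha ihb =>
      subst hi
      obtain ⟨⟨k, rfl⟩, l, rfl⟩ := hf _ _ _ h
      exact .prod h (iha rfl) (ihb rfl)

theorem solution_comap {f : J → I} {E : AlgebraicSystem I M}
    (hf : ∀ j i k, (f j, i, k) ∈ E.prod → i ∈ Set.range f ∧ k ∈ Set.range f) {s : Set I}
    (hs : s ⊆ Set.range f) : (E.comap f).solution (f ⁻¹' s) = E.solution s := by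
  ext m
  simp only [solution, derives_comap_iff hf, Set.mem_ofPred_eq, Set.mem_preimage]
  constructor
  · rintro ⟨j, hj, h⟩
    exact ⟨f j, hj, h⟩
  · rintro ⟨i, hi, h⟩
    obtain ⟨j, rfl⟩ := hs hi
    exact ⟨j, hi, h⟩

/-- The disjoint union of two systems. -/
def sum (E : AlgebraicSystem I M) (F : AlgebraicSystem J M) : AlgebraicSystem (I ⊕ J) M where
  const := Prod.map .inl id '' E.const ∪ Prod.map .inr id '' F.const
  prod := Prod.map .inl (Prod.map .inl .inl) '' E.prod ∪
    Prod.map .inr (Prod.map .inr .inr) '' F.prod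

theorem derives_sum_inl {E : AlgebraicSystem I M} {F : AlgebraicSystem J M} {i : I} {m : M} :
    (E.sum F).Derives (.inl i) m ↔ E.Derives i m := by
  have hcomap : (E.sum F).comap .inl = E := by simp [sum, comap]
  rw [← derives_comap_iff (E := E.sum F) (f := .inl) (by simp [sum]), hcomap]

theorem derives_sum_inr {E : AlgebraicSystem I M} {F : AlgebraicSystem J M} {j : J} {m : M} :
    (E.sum F).Derives (.inr j) m ↔ F.Derives j m := by
  have hcomap : (E.sum F).comap .inr = F := by simp [sum, comap]
  rw [← derives_comap_iff (E := E.sum F) (f := .inr) (by simp [sum]), hcomap]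

/-- The system with a further equation, whose index is `none`. -/
def adjoin (E : AlgebraicSystem I M) (C : Set M) (B : Set (Option I × Option I)) :
    AlgebraicSystem (Option I) M where
  const := Prod.map some id '' E.const ∪ Prod.mk none '' C
  prod := Prod.map some (Prod.map some some) '' E.prod ∪ Prod.mk none '' B

theorem derives_adjoin_some {E : AlgebraicSystem I M} {C : Set M} {B : Set (Option I × Option I)}
    {i : I} {m : M} : (E.adjoin C B).Derives (some i) m ↔ E.Derives i m := by
  have hcomap : (E.adjoin C B).comap some = E := by simp [adjoin, comap]
  rw [← derives_comap_iff (E := E.adjoin C B) (f := some), hcomap]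
  rintro j _ _ (⟨⟨_, i, k⟩, -, ⟨⟩⟩ | ⟨_, -, ⟨⟩⟩)
  exact ⟨⟨i, rfl⟩, k, rfl⟩

theorem derives_adjoin_none {E : AlgebraicSystem I M} {C : Set M} {B : Set (Option I × Option I)}
    {m : M} : (E.adjoin C B).Derives none m ↔ m ∈ C ∨ ∃ x ∈ B, ∃ a b,
      (E.adjoin C B).Derives x.1 a ∧ (E.adjoin C B).Derives x.2 b ∧ a * b = m := by
  constructor
  · rintro (h | ⟨h, ha, hb⟩)
    · exact .inl (by simpa [adjoin] using h)
    · exact .inr ⟨_, by simpa [adjoin] using h, _, _, ha, hb, rfl⟩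
  · rintro (h | ⟨⟨j, k⟩, hB, a, b, ha, hb, rfl⟩)
    · exact .const (.inr ⟨m, h, rfl⟩)
    · exact .prod (.inr ⟨(j, k), hB, rfl⟩) ha hb

end AlgebraicSystem

variable {I M N : Type*} [Monoid M] [Monoid N]

/-- Unions of components of the least solutions of finite algebraic systems. The indices are
taken in `Fin n` for the sake of universe levels. -/
def IsAlgebraicSubset (S : Set M) : Prop :=
  ∃ n, ∃ E : AlgebraicSystem (Fin n) M, E.const.Finite ∧ ∃ s, E.solution s = S

theorem AlgebraicSystem.isAlgebraicSubset_of_closed {E : AlgebraicSystem I M} {J : Set I}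
    (hJ : J.Finite) (hclosed : ∀ i ∈ J, ∀ j k, (i, j, k) ∈ E.prod → j ∈ J ∧ k ∈ J)
    (hconst : {x ∈ E.const | x.1 ∈ J}.Finite) {s : Set I} (hs : s ⊆ J) :
    IsAlgebraicSubset (E.solution s) := by
  obtain ⟨n, f, hf, rfl⟩ := hJ.fin_param
  refine ⟨n, E.comap f, ?_, f ⁻¹' s, solution_comap (fun j => hclosed _ ⟨j, rfl⟩) hs⟩
  refine (hconst.preimage (hf.prodMap Function.injective_id).injOn).subset ?_
  exact fun x hx => ⟨hx, x.1, rfl⟩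

theorem AlgebraicSystem.isAlgebraicSubset_solution [Finite I] {E : AlgebraicSystem I M}
    (hE : E.const.Finite) (s : Set I) : IsAlgebraicSubset (E.solution s) :=
  isAlgebraicSubset_of_closed Set.finite_univ (fun _ _ _ _ _ => ⟨trivial, trivial⟩)
    (hE.subset (Set.sep_subset _ _)) (Set.subset_univ s)

namespace IsAlgebraicSubset

variable {S T : Set M}

theorem of_finite (hS : S.Finite) : IsAlgebraicSubset S := by
  let E : AlgebraicSystem Unit M := ⟨Prod.mk () '' S, ∅⟩
  have hE : E.solution Set.univ = S := by
    ext m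
    constructor
    · rintro ⟨i, -, h⟩
      cases h with
      | const h => simpa [E] using h
      | prod h => exact h.elim
    · exact fun hm => ⟨(), trivial, .const ⟨m, hm, rfl⟩⟩
  exact hE ▸ AlgebraicSystem.isAlgebraicSubset_solution (hS.image _) _

theorem exists_common_system (hS : IsAlgebraicSubset S) (hT : IsAlgebraicSubset T) :
    ∃ (I : Type) (_ : Finite I) (E : AlgebraicSystem I M) (s t : Set I),
      E.const.Finite ∧ E.solution s = S ∧ E.solution t = T := by
  obtain ⟨m, E, hE, s, rfl⟩ := hS
  obtain ⟨n, F, hF, t, rfl⟩ := hT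
  refine ⟨Fin m ⊕ Fin n, inferInstance, E.sum F, .inl '' s, .inr '' t,
    (hE.image _).union (hF.image _), ?_, ?_⟩
  · ext; simp [AlgebraicSystem.solution, AlgebraicSystem.derives_sum_inl]
  · ext; simp [AlgebraicSystem.solution, AlgebraicSystem.derives_sum_inr]

theorem union (hS : IsAlgebraicSubset S) (hT : IsAlgebraicSubset T) :
    IsAlgebraicSubset (S ∪ T) := by
  obtain ⟨I, _, E, s, t, hE, rfl, rfl⟩ := exists_common_system hS hT
  have hunion : E.solution (s ∪ t) = E.solution s ∪ E.solution t := by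
    ext; simp only [AlgebraicSystem.solution, Set.mem_union, or_and_right, exists_or,
      Set.mem_ofPred_eq]
  exact hunion ▸ AlgebraicSystem.isAlgebraicSubset_solution hE _

theorem mul (hS : IsAlgebraicSubset S) (hT : IsAlgebraicSubset T) :
    IsAlgebraicSubset (S * T) := by
  obtain ⟨I, _, E, s, t, hE, rfl, rfl⟩ := exists_common_system hS hT
  let F := E.adjoin ∅ ((some '' s) ×ˢ (some '' t))
  have hmul : F.solution {none} = E.solution s * E.solution t := by
    ext m
    simp only [AlgebraicSystem.solution, Set.mem_singleton_iff, exists_eq_left, Set.mem_ofPred_eq,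
      F, AlgebraicSystem.derives_adjoin_none, Set.mem_empty_iff_false, false_or, Set.mem_mul]
    constructor
    · rintro ⟨⟨_, _⟩, ⟨⟨i, hi, rfl⟩, j, hj, rfl⟩, a, b, ha, hb, rfl⟩
      exact ⟨a, ⟨i, hi, AlgebraicSystem.derives_adjoin_some.1 ha⟩,
        b, ⟨j, hj, AlgebraicSystem.derives_adjoin_some.1 hb⟩, rfl⟩
    · rintro ⟨a, ⟨i, hi, ha⟩, b, ⟨j, hj, hb⟩, rfl⟩
      exact ⟨(some i, some j), ⟨⟨i, hi, rfl⟩, j, hj, rfl⟩, a, b,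
        AlgebraicSystem.derives_adjoin_some.2 ha, AlgebraicSystem.derives_adjoin_some.2 hb, rfl⟩
  have hF : F.const.Finite := (hE.image _).union (Set.finite_empty.image _)
  exact hmul ▸ AlgebraicSystem.isAlgebraicSubset_solution hF _

theorem closure (hS : IsAlgebraicSubset S) :
    IsAlgebraicSubset (Submonoid.closure S : Set M) := by
  obtain ⟨n, E, hE, s, rfl⟩ := hS
  let F := E.adjoin {1} ((some '' s) ×ˢ {none})
  have hclosure : F.solution {none} = Submonoid.closure (E.solution s) := by
    refine Set.Subset.antisymm ?_ fun m hm => ⟨none, rfl, ?_⟩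
    · rintro m ⟨i, rfl, h⟩
      generalize hi : none = i at h
      induction h with
      | const h =>
        obtain ⟨_, -, ⟨⟩⟩ | ⟨_, rfl, ⟨⟩⟩ := hi ▸ h
        exact one_mem _
      | prod h ha _ _ ihb =>
        obtain ⟨_, -, ⟨⟩⟩ | ⟨⟨_, _⟩, ⟨⟨i, hi, rfl⟩, rfl⟩, ⟨⟩⟩ := hi ▸ h
        have ha : _ ∈ E.solution s := ⟨i, hi, AlgebraicSystem.derives_adjoin_some.1 ha⟩
        exact mul_mem (Submonoid.subset_closure ha) (ihb rfl)
    · induction hm using Submonoid.closure_induction_left with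
      | one => exact .const (.inr ⟨1, rfl, rfl⟩)
      | mul_left a ha b _ hb =>
        obtain ⟨i, hi, ha⟩ := ha
        exact .prod (.inr ⟨(some i, none), ⟨⟨i, hi, rfl⟩, rfl⟩, rfl⟩)
          (AlgebraicSystem.derives_adjoin_some.2 ha) hb
  have hF : F.const.Finite := (hE.image _).union ((Set.finite_singleton 1).image _)
  exact hclosure ▸ AlgebraicSystem.isAlgebraicSubset_solution hF _

theorem exists_image_eq (hS : IsAlgebraicSubset S) {π : N →* M} (hπ : Function.Surjective π) :
    ∃ T : Set N, IsAlgebraicSubset T ∧ π '' T = S := by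
  obtain ⟨n, E, hE, s, rfl⟩ := hS
  let F := E.map (Function.surjInv hπ)
  have hF : F.map π = E := by
    simp [F, AlgebraicSystem.map, Set.image_image, Prod.map, Function.surjInv_eq]
  exact ⟨F.solution s, ⟨n, F, hE.image _, s, rfl⟩, by rw [← AlgebraicSystem.solution_map, hF]⟩

end IsAlgebraicSubset

theorem IsRationalSubset.isAlgebraicSubset {S : Set M} (hS : IsRationalSubset S) :
    IsAlgebraicSubset S := by
  induction hS with
  | finite S hS => exact .of_finite hS
  | union S T _ _ hS hT => exact hS.union hT
  | mul S T _ _ hS hT => exact hS.mul hT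
  | star S _ hS => exact hS.closure

end AlgebraicSystem

section AlgebraicSubsetsOfFreeMonoids

variable {I X : Type*}

namespace AlgebraicSystem

open scoped Classical in
/-- The indices of the equations with a term for the product of the components `i` and `j`. -/
noncomputable def heads [Fintype I] {M : Type*} (E : AlgebraicSystem I M) (j k : I) : List I :=
  {i | (i, j, k) ∈ E.prod}.toFinset.toList

theorem mem_heads [Fintype I] {M : Type*} {E : AlgebraicSystem I M} {i j k : I} :
    i ∈ E.heads j k ↔ (i, j, k) ∈ E.prod := by simp [heads]

/-- The consequences of two derivations, each recorded as an index and an element. -/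
noncomputable def combine [Fintype I] {M : Type*} [Mul M] (E : AlgebraicSystem I M) (x y : I × M) :
    List (I × M) :=
  (E.heads x.1 y.1).map fun i => (i, x.2 * y.2)

theorem derives_iff_generated [Fintype I] {M : Type*} [Monoid M] {E : AlgebraicSystem I M} {i : I}
    {m : M} : E.Derives i m ↔ Generated E.const E.combine (i, m) := by
  constructor
  · intro h
    induction h with
    | const h => exact .base h
    | prod h _ _ iha ihb => exact .step iha ihb (List.mem_map_of_mem (mem_heads.2 h))
  · intro h
    generalize hx : (i, m) = x at h
    induction h generalizing i m with
    | base h => subst hx; exact .const h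
    | step _ _ hmem iha ihb =>
      obtain ⟨j, hj, rfl⟩ := List.mem_map.1 hmem
      cases hx
      exact .prod (mem_heads.1 hj) (iha rfl) (ihb rfl)

variable [Primcodable I] [Primcodable X] {E : AlgebraicSystem I (FreeMonoid X)}

theorem computable_combine [Fintype I] : Computable₂ E.combine := by
  have hheads : Primrec₂ E.heads := Primrec.dom_finite _
  have hindex : Primrec fun z : (I × FreeMonoid X) × I × FreeMonoid X => E.heads z.1.1 z.2.1 :=
    hheads.comp (Primrec.fst.comp Primrec.fst) (Primrec.fst.comp Primrec.snd)
  have hmul : Primrec fun z : (I × FreeMonoid X) × I × FreeMonoid X => z.1.2 * z.2.2 :=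
    Primrec.list_append.comp (Primrec.snd.comp Primrec.fst) (Primrec.snd.comp Primrec.snd)
  have hcombine : Primrec fun z : (I × FreeMonoid X) × I × FreeMonoid X => E.combine z.1 z.2 :=
    Primrec.list_map hindex (Primrec.snd.pair (hmul.comp Primrec.fst)).to₂
  exact hcombine.to_comp

theorem rePred_derives [Finite I] (hE : E.const.Finite) :
    REPred fun x : I × FreeMonoid X => E.Derives x.1 x.2 := by
  cases nonempty_fintype I
  simp only [derives_iff_generated]
  exact rePred_generated (rePred_mem_of_finite hE) computable_combine

end AlgebraicSystem

variable [Primcodable X] {T : Set (FreeMonoid X)}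

theorem IsAlgebraicSubset.rePred_mem (hT : IsAlgebraicSubset T) : REPred (· ∈ T) := by
  obtain ⟨n, E, hE, s, rfl⟩ := hT
  exact rePred_exists (rePred_and (rePred_comp (rePred_mem_of_finite s.toFinite) .snd)
    (rePred_comp (E.rePred_derives hE) (Computable.snd.pair .fst)))

theorem IsAlgebraicSubset.rePred_forall_not_con (hT : IsAlgebraicSubset T) :
    REPred fun x : AutomatonCode × FreeMonoid X => ∀ u ∈ T, ¬ x.1.con u x.2 := by
  obtain ⟨n, E, hE, s, rfl⟩ := hT
  let classOf (x : AutomatonCode × FreeMonoid X) (y : Fin n × FreeMonoid X) :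
      Fin n × (x.1.con : Con (FreeMonoid X)).Quotient := (y.1, y.2)
  have hsep : REPred fun x : AutomatonCode × FreeMonoid X =>
      ∀ y z, Generated E.const E.combine y → Generated E.const E.combine z →
        y.1 ∈ sᶜ ∨ ¬ x.1.con y.2 x.2 := by
    refine rePred_forall_generated classOf ?_ hE AlgebraicSystem.computable_combine ?_ ?_ ?_
    · simp only [classOf, Prod.mk.injEq, Con.eq]
      exact rePred_and (rePred_eq (by fun_prop) (by fun_prop))
        (AutomatonCode.rePred_con (by fun_prop) (by fun_prop) (by fun_prop))
    · rintro x ⟨i, u⟩ ⟨i', u'⟩ ⟨j, v⟩ ⟨j', v'⟩ hu hv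
      simp only [classOf, Prod.mk.injEq] at hu hv
      obtain ⟨rfl, hu⟩ := hu
      obtain ⟨rfl, hv⟩ := hv
      simp [classOf, AlgebraicSystem.combine, hu, hv]
    · exact rePred_or (rePred_comp (rePred_mem_of_finite sᶜ.toFinite) (by fun_prop))
        (AutomatonCode.rePred_not_con (by fun_prop) (by fun_prop) (by fun_prop))
    · rintro x ⟨i, u⟩ ⟨i', u'⟩ y y' hu -
      simp only [classOf, Prod.mk.injEq] at hu
      obtain ⟨rfl, hu⟩ := hu
      simp only [← Con.eq, hu, imp_self]
  refine hsep.of_eq fun x => ?_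
  simp only [AlgebraicSystem.solution, AlgebraicSystem.derives_iff_generated]
  constructor
  · rintro h u ⟨i, hi, hu⟩
    exact (h _ _ hu hu).resolve_left (not_not_intro hi)
  · rintro h y - hy -
    exact (em (y.1 ∈ sᶜ)).imp_right fun hi => h _ ⟨y.1, not_not.1 hi, hy⟩

end AlgebraicSubsetsOfFreeMonoids

section ContextFree

variable {A : Type*} {g : ContextFreeGrammar A}

/-- The equations for the terminal words that derive from the sentential forms of `g`: a form is
split after its first letter, to which a rule is applied if it is a nonterminal. -/
def sententialSystem (g : ContextFreeGrammar A) :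
    AlgebraicSystem (List (Symbol A g.NT)) (FreeMonoid A) where
  const := insert ([], 1) (Set.range fun a => ([.terminal a], .of a))
  prod := {x | ∃ l, (∃ a, x = (.terminal a :: l, [.terminal a], l)) ∨
    ∃ r ∈ g.rules, x = (.nonterminal r.input :: l, r.output, l)}

namespace sententialSystem

theorem derives_nil : (sententialSystem g).Derives [] 1 := .const (Set.mem_insert _ _)

theorem derives_terminal (a : A) : (sententialSystem g).Derives [.terminal a] (.of a) :=
  .const (Set.mem_insert_of_mem _ ⟨a, rfl⟩)

theorem derives_terminal_cons (a : A) {l : List (Symbol A g.NT)} {u : FreeMonoid A}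
    (hu : (sententialSystem g).Derives l u) :
    (sententialSystem g).Derives (.terminal a :: l) (.of a * u) :=
  .prod ⟨l, .inl ⟨a, rfl⟩⟩ (derives_terminal a) hu

theorem derives_nonterminal_cons {r : ContextFreeRule A g.NT} (hr : r ∈ g.rules)
    {l : List (Symbol A g.NT)} {u v : FreeMonoid A}
    (hu : (sententialSystem g).Derives r.output u) (hv : (sententialSystem g).Derives l v) :
    (sententialSystem g).Derives (.nonterminal r.input :: l) (u * v) :=
  .prod ⟨l, .inr ⟨r, hr, rfl⟩⟩ hu hv

theorem derives_append {l₁ l₂ : List (Symbol A g.NT)} {u v : FreeMonoid A}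
    (hu : (sententialSystem g).Derives l₁ u) (hv : (sententialSystem g).Derives l₂ v) :
    (sententialSystem g).Derives (l₁ ++ l₂) (u * v) := by
  induction hu with
  | const h =>
    obtain h | ⟨a, ⟨⟩⟩ := h
    · cases h
      rwa [one_mul]
    · exact derives_terminal_cons a hv
  | prod h hj _ _ ih =>
    obtain ⟨l, ⟨a, ⟨⟩⟩ | ⟨r, hr, ⟨⟩⟩⟩ := h
    · exact mul_assoc _ _ v ▸ .prod ⟨_, .inl ⟨a, rfl⟩⟩ hj ih
    · exact mul_assoc _ _ v ▸ derives_nonterminal_cons hr hj ih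

theorem exists_of_derives_append {l₁ l₂ : List (Symbol A g.NT)} {w : FreeMonoid A}
    (h : (sententialSystem g).Derives (l₁ ++ l₂) w) :
    ∃ u v, (sententialSystem g).Derives l₁ u ∧ (sententialSystem g).Derives l₂ v ∧ u * v = w := by
  induction l₁ generalizing w with
  | nil => exact ⟨1, w, derives_nil, h, one_mul w⟩
  | cons s l ih =>
    generalize hs : s :: l ++ l₂ = k at h
    cases h with
    | const h =>
      obtain h | ⟨a, ⟨⟩⟩ := h
      · cases h
        cases hs
      · obtain ⟨rfl, rfl, rfl⟩ : s = .terminal a ∧ l = [] ∧ l₂ = [] := by simpa using hs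
        exact ⟨.of a, 1, derives_terminal a, derives_nil, mul_one _⟩
    | prod h hj hk =>
      obtain ⟨k, ⟨a, ⟨⟩⟩ | ⟨r, hr, ⟨⟩⟩⟩ := h
      · obtain ⟨rfl, rfl⟩ := List.cons.inj hs
        obtain ⟨u, v, hu, hv, rfl⟩ := ih hk
        exact ⟨_ * u, v, .prod ⟨l, .inl ⟨a, rfl⟩⟩ hj hu, hv, mul_assoc _ _ _⟩
      · obtain ⟨rfl, rfl⟩ := List.cons.inj hs
        obtain ⟨u, v, hu, hv, rfl⟩ := ih hk
        exact ⟨_ * u, v, derives_nonterminal_cons hr hj hu, hv, mul_assoc _ _ _⟩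

theorem derives_of_produces {l l' : List (Symbol A g.NT)} {w : FreeMonoid A}
    (hl : g.Produces l l') (hw : (sententialSystem g).Derives l' w) :
    (sententialSystem g).Derives l w := by
  obtain ⟨r, hr, hrewrite⟩ := hl
  obtain ⟨p, q, rfl, rfl⟩ := hrewrite.exists_parts
  rw [List.append_assoc] at hw ⊢
  obtain ⟨u, _, hu, hvw, rfl⟩ := exists_of_derives_append hw
  obtain ⟨v, z, hv, hz, rfl⟩ := exists_of_derives_append hvw
  exact derives_append hu (derives_nonterminal_cons hr hv hz)

theorem derives_iff {l : List (Symbol A g.NT)} {u : FreeMonoid A} :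
    (sententialSystem g).Derives l u ↔ g.Derives l (u.toList.map .terminal) := by
  constructor
  · intro h
    induction h with
    | const h =>
      obtain h | ⟨a, ⟨⟩⟩ := h
      · cases h
        exact .refl _
      · exact .refl _
    | prod h _ _ iha ihb =>
      rw [FreeMonoid.toList_mul, List.map_append]
      have happend := (iha.append_right _).trans (ihb.append_left _)
      obtain ⟨l, ⟨a, ⟨⟩⟩ | ⟨r, hr, ⟨⟩⟩⟩ := h
      · exact happend
      · exact .head ⟨r, hr, .head _⟩ happend
  · intro h
    induction h using Relation.ReflTransGen.head_induction_on with
    | refl =>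
      induction u using FreeMonoid.inductionOn' with
      | one => exact derives_nil
      | of_mul a u ih => exact derives_terminal_cons a ih
    | head h _ ih => exact derives_of_produces h ih

theorem exists_finite_closed [Finite A] (g : ContextFreeGrammar A) :
    ∃ J : Set (List (Symbol A g.NT)), J.Finite ∧ [.nonterminal g.initial] ∈ J ∧
      ∀ i ∈ J, ∀ j k, (i, j, k) ∈ (sententialSystem g).prod → j ∈ J ∧ k ∈ J := by
  let forms : Set (List (Symbol A g.NT)) :=
    insert [.nonterminal g.initial] (ContextFreeRule.output '' (g.rules : Set _)) ∪
      Set.range fun a => [.terminal a]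
  have hforms : forms.Finite :=
    ((g.rules.finite_toSet.image _).insert _).union (Set.finite_range _)
  refine ⟨{l | ∃ f ∈ forms, l <:+ f}, ?_, ⟨_, .inl (.inl rfl), List.suffix_rfl⟩, ?_⟩
  · refine (hforms.biUnion fun f _ => f.tails.finite_toSet).subset ?_
    rintro l ⟨f, hf, hl⟩
    exact Set.mem_biUnion hf ((List.mem_tails _ _).2 hl)
  · rintro _ ⟨f, hf, hl⟩ _ _ ⟨_, ⟨a, ⟨⟩⟩ | ⟨r, hr, ⟨⟩⟩⟩
    · exact ⟨⟨_, .inr ⟨a, rfl⟩, List.suffix_rfl⟩, f, hf, (List.suffix_cons _ _).trans hl⟩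
    · exact ⟨⟨_, .inl (.inr ⟨r, hr, rfl⟩), List.suffix_rfl⟩, f, hf,
        (List.suffix_cons _ _).trans hl⟩

end sententialSystem

theorem isAlgebraicSubset_languageImage [Finite A] {M : Type*} [Monoid M] (φ : FreeMonoid A →* M)
    {L : Language A} (hL : L.IsContextFree) : IsAlgebraicSubset (languageImage φ L) := by
  obtain ⟨g, rfl⟩ := hL
  obtain ⟨J, hJ, hinitial, hclosed⟩ := sententialSystem.exists_finite_closed g
  have hconst : ((sententialSystem g).map φ).const.Finite :=
    ((Set.finite_range _).insert _).image _
  have himage : ((sententialSystem g).map φ).solution {[.nonterminal g.initial]} =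
      languageImage φ g.language := by
    ext m
    simp only [AlgebraicSystem.solution, AlgebraicSystem.derives_map_iff,
      sententialSystem.derives_iff, Set.mem_singleton_iff, exists_eq_left]
    rfl
  exact himage ▸ AlgebraicSystem.isAlgebraicSubset_of_closed (E := (sententialSystem g).map φ) hJ
    hclosed (hconst.subset (Set.sep_subset _ _)) (Set.singleton_subset_iff.2 hinitial)

end ContextFree

section Membership

variable {M X : Type*} [Monoid M] {S : Set M}

theorem IsProfinitelyClosed.exists_ker_le {N : Type*} [Monoid N] (hS : IsProfinitelyClosed S)
    (π : N →* M) {w : N} (hw : π w ∉ S) : ∃ d : Con N, Finite d.Quotient ∧ Con.ker π ≤ d ∧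
      ∀ u, π u ∈ S → ¬ d u w := by
  obtain ⟨d, _, hd⟩ := hS _ hw
  refine ⟨Con.ker (d.mk'.comp π), .of_injective _ (Con.kerLift_injective _), ?_, ?_⟩
  · exact Con.le_def.2 fun h => congrArg d.mk' ((Con.ker_rel _).1 h)
  · exact fun u hu h => hd _ hu ((Con.eq d).1 ((Con.ker_rel _).1 h))

/-- Membership is semidecided by enumerating `T`, and nonmembership by searching for an automaton
that respects `Con.ker π` and separates the word from `T`. -/
theorem computablePred_map_mem_image [Finite X] [Primcodable X] {π : FreeMonoid X →* M}
    (hker : REPred fun x : FreeMonoid X × FreeMonoid X => Con.ker π x.1 x.2)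
    (hquot : REPred fun c : AutomatonCode => Con.ker π ≤ c.con) {T : Set (FreeMonoid X)}
    (hT : IsAlgebraicSubset T) (hclosed : IsProfinitelyClosed (π '' T)) :
    ComputablePred fun w => π w ∈ π '' T := by
  refine ComputablePred.computable_iff_re_compl_re'.2 ⟨?_, ?_⟩
  · exact rePred_exists (rePred_and (rePred_comp hT.rePred_mem .snd)
      (rePred_comp hker (Computable.snd.pair .fst)))
  · have hseparated : REPred fun w : FreeMonoid X => ∃ c : AutomatonCode, Con.ker π ≤ c.con ∧
        ∀ u ∈ T, ¬ c.con u w :=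
      rePred_exists (rePred_and (rePred_comp hquot .snd)
        (rePred_comp hT.rePred_forall_not_con (Computable.snd.pair .fst)))
    refine hseparated.of_eq fun w => ⟨?_, fun hw => ?_⟩
    · rintro ⟨c, hc, hsep⟩ ⟨u, hu, huw⟩
      exact hsep u hu (Con.le_def.1 hc ((Con.ker_rel _).2 huw))
    · obtain ⟨d, _, hle, hsep⟩ := hclosed.exists_ker_le π hw
      obtain ⟨c, rfl⟩ := AutomatonCode.exists_con_eq d
      exact ⟨c, hle, fun u hu => hsep u ⟨u, hu, rfl⟩⟩

theorem membershipSolvable_of_computablePred [Finite X] [Primcodable X] {π : FreeMonoid X →* M}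
    (hπ : Function.Surjective π) (hS : ComputablePred fun w => π w ∈ S) :
    MembershipSolvable S := by
  refine ⟨Monoid.fg_of_surjective π hπ, fun k g _ => ?_⟩
  obtain ⟨σ, hσ⟩ := hπ.hasRightInverse
  let translate (w : List (Fin k)) : FreeMonoid X :=
    .ofList (w.flatMap fun j => (σ (g j)).toList)
  have htranslate : Primrec translate :=
    Primrec.list_flatMap .id ((Primrec.dom_finite fun j => (σ (g j)).toList).comp .snd)
  have hvalue (w : List (Fin k)) : π (translate w) = (w.map g).prod := by
    induction w with
    | nil => exact map_one π
    | cons j w ih =>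
      have hcons : translate (j :: w) = σ (g j) * translate w := rfl
      rw [hcons, map_mul, hσ, ih, List.map_cons, List.prod_cons]
  simp only [← hvalue]
  exact hS.computable_of_manyOneReducible ⟨translate, htranslate.to_comp, fun _ => Iff.rfl⟩

theorem HasFiniteInvPresentation.exists_hom (hM : HasFiniteInvPresentation M) :
    ∃ (n : ℕ) (R : Set (InvWord (Fin n) × InvWord (Fin n))) (π : InvWord (Fin n) →* M),
      R.Finite ∧ Function.Surjective π ∧ Con.ker π = conGen (InvRel R) := by
  obtain ⟨n, R, hR, ⟨e⟩⟩ := hM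
  refine ⟨n, R, e.toMonoidHom.comp (PresentedMonoid.mk _), hR,
    e.surjective.comp PresentedMonoid.surjective_mk, Con.ext fun u v => ?_⟩
  rw [← PresentedMonoid.mk_eq_mk_iff]
  exact e.injective.eq_iff

theorem IsAlgebraicSubset.membershipSolvable (hS : IsAlgebraicSubset S)
    (hM : HasFiniteInvPresentation M) (hclosed : IsProfinitelyClosed S) :
    MembershipSolvable S := by
  obtain ⟨n, R, π, hR, hπ, hker⟩ := hM.exists_hom
  obtain ⟨T, hT, rfl⟩ := hS.exists_image_eq hπ
  refine membershipSolvable_of_computablePred hπ (computablePred_map_mem_image ?_ ?_ hT hclosed)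
  · exact hker ▸ rePred_conGen (rePred_invRel hR)
  · exact hker ▸ rePred_conGen_invRel_le hR

end Membership

end InvMon

theorem corollary3p11 {M : Type*} [Monoid M]
    (hinv : InvMon.IsInverseMonoid M)
    (hpres : InvMon.HasFiniteInvPresentation M)
    (hfin : InvMon.FiniteJAbove M) :
    (∀ (A : Type*) [Finite A] (φ : FreeMonoid A →* M) (L : Language A),
      L.IsContextFree → InvMon.MembershipSolvable (InvMon.languageImage φ L)) ∧
    (∀ S : Set M, InvMon.IsRationalSubset S → InvMon.MembershipSolvable S) ∧
    (∀ N : Submonoid M, N.FG → InvMon.MembershipSolvable (N : Set M)) := by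
  have hsolvable {S : Set M} (hS : InvMon.IsAlgebraicSubset S) : InvMon.MembershipSolvable S :=
    hS.membershipSolvable hpres (hfin.isProfinitelyClosed S)
  have hrational (S : Set M) (hS : InvMon.IsRationalSubset S) : InvMon.MembershipSolvable S :=
    hsolvable hS.isAlgebraicSubset
  refine ⟨fun A _ φ L hL => hsolvable (InvMon.isAlgebraicSubset_languageImage φ hL), hrational, ?_⟩
  rintro _ ⟨s, rfl⟩
  exact hrational _ (.star _ (.finite _ s.finite_toSet))
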